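/- Let $N\ge 1$ be an integer. For nonnegative integers $m,n$ let $$H_{m,n}(z_1,z_2)=\sum_{k=0}^{\min(m,n)}(-1)^k k!\binom mk\binom nk z_1^{m-k}z_2^{n-k}$$ be the complex Hermite polynomials. For a complex $N\times N$ matrix $H=(h_{m,n})$ put $\|H\|_\infty=\max_{1\le j,\ell\le N}|h_{j,\ell}|$, and let $B=\{H\in\mathbb C^{N\times N}:\|H\|_\infty<\tfrac1N\}$. For $W=(w_1,\dots,w_N)^T\in\mathbb C^N$ consider the series $$\Sigma(H,W)=\sum_{K}\ \prod_{1\le m,n\le N}\frac{h_{m,n}^{k_{m,n}}}{k_{m,n}!}\ \prod_{j=1}^N H_{r_j,c_j}(\overline{w_j},w_j),$$ where $K=(k_{m,n})$ runs over all $N\times N$ matrices with nonnegative integer entries, $r_m=\sum_{\ell}k_{m,\ell}$ is the sum of row $m$ and $c_n=\sum_j k_{j,n}$ is the sum of column $n$ of $K$. (a) The series $\Sigma(H,W)$ converges absolutely and uniformly for $W$ in any compact subset of $\mathbb C^N$ and $H$ in any compact subset of $B$ (that is, both the series and the series of absolute values of its terms converge uniformly there). (b) For $\ell<k$ put $u_{\ell,k}=\frac{h_{\ell,k}+h_{k,\ell}}2$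 and $v_{\ell,k}=\frac{h_{\ell,k}-h_{k,\ell}}{2i}$. Given a Hermitian matrix $H_0=(h^{(0)}_{j,k})\in B$, with corresponding $u^{(0)}_{\ell,k},v^{(0)}_{\ell,k}$, and numbers $\delta_{j,k}>0$ $(1\le j,k\le N)$, let $D(H_0,\delta)$ be the set of all $H\in\mathbb C^{N\times N}$ with $|h_{j,j}-h^{(0)}_{j,j}|<\delta_{j,j}$ for all $j$, and $|u_{\ell,k}-u^{(0)}_{\ell,k}|<\delta_{\ell,k}$ and $|v_{\ell,k}-v^{(0)}_{\ell,k}|<\delta_{\ell,k}$ for all $\ell<k$. If $D(H_0,\delta)\subset B$, then for all $H\in D(H_0,\delta)$ and all $W\in\mathbb C^N$ the matrix $I_N+H$ is invertible and $$\Sigma(H,W)=\det(I_N+H)^{-1}\exp\left(W^*H(I_N+H)^{-1}W\right),$$ equivalently $\exp\left(W^*H(I_N+H)^{-1}W\right)=\det(I_N+H)\,\Sigma(H,W)$. (c) In particular this applies with $H_0=0$, $\delta_{j,j}=\frac1N$ and $\delta_{j,k}=\frac1{2N}$ for $j\ne k$: for these, $D(H_0,\delta)\subset B$. -/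

import Mathlib

open scoped Matrix Nat ComplexConjugate

/-- The complex Hermite polynomials
`H_{m,n}(z₁, z₂) = ∑_{k=0}^{min m n} (-1)^k k! (m choose k) (n choose k) z₁^{m-k} z₂^{n-k}`. -/
noncomputable def complexHermite (m n : ℕ) (z₁ z₂ : ℂ) : ℂ :=
  ∑ k ∈ Finset.range (min m n + 1),
    (-1 : ℂ) ^ k * (k ! : ℂ) * (m.choose k : ℂ) * (n.choose k : ℂ) * z₁ ^ (m - k) * z₂ ^ (n - k)

/-- The sum `r_m` of the entries of `K` in row `m`. -/
def rowTotal {N : ℕ} (K : Matrix (Fin N) (Fin N) ℕ) (m : Fin N) : ℕ := ∑ l, K m l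

/-- The sum `c_n` of the entries of `K` in column `n`. -/
def colTotal {N : ℕ} (K : Matrix (Fin N) (Fin N) ℕ) (n : Fin N) : ℕ := ∑ j, K j n

/-- The term of the multilinear series with index `K`, a matrix of nonnegative integers:
`∏_{m,n} h_{m,n}^{k_{m,n}} / k_{m,n}! · ∏_j H_{r_j,c_j}(w̄_j, w_j)`. -/
noncomputable def multilinearTerm {N : ℕ} (K : Matrix (Fin N) (Fin N) ℕ)
    (H : Matrix (Fin N) (Fin N) ℂ) (W : Fin N → ℂ) : ℂ :=
  (∏ m, ∏ n, H m n ^ K m n / ((K m n)! : ℂ)) *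
    ∏ j, complexHermite (rowTotal K j) (colTotal K j) (conj (W j)) (W j)

section MaxNorm

attribute [local instance] Matrix.normedAddCommGroup

/-- The set `B` of complex `N × N` matrices `H` with `‖H‖_∞ < 1 / N`. The norm here is Mathlib's
entrywise sup norm on matrices, `‖H‖_∞ = max_{j,l} |h_{j,l}|`. -/
def maxNormBall (N : ℕ) : Set (Matrix (Fin N) (Fin N) ℂ) := {H | ‖H‖ < 1 / (N : ℝ)}

end MaxNorm

/-- `u_{l,k} = (h_{l,k} + h_{k,l}) / 2`. -/
noncomputable def uCoord {N : ℕ} (H : Matrix (Fin N) (Fin N) ℂ) (l k : Fin N) : ℂ :=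
  (H l k + H k l) / 2

/-- `v_{l,k} = (h_{l,k} - h_{k,l}) / (2i)`. -/
noncomputable def vCoord {N : ℕ} (H : Matrix (Fin N) (Fin N) ℂ) (l k : Fin N) : ℂ :=
  (H l k - H k l) / (2 * Complex.I)

/-- The polydisc `D(H₀, δ)` in the coordinates `h_{j,j}`, and `u_{l,k}`, `v_{l,k}` for `l < k`. -/
def polydiscAt {N : ℕ} (H₀ : Matrix (Fin N) (Fin N) ℂ) (δ : Matrix (Fin N) (Fin N) ℝ) :
    Set (Matrix (Fin N) (Fin N) ℂ) :=
  {H | (∀ j, ‖H j j - H₀ j j‖ < δ j j) ∧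
    ∀ l k, l < k → ‖uCoord H l k - uCoord H₀ l k‖ < δ l k ∧
      ‖vCoord H l k - vCoord H₀ l k‖ < δ l k}

/-!
Write `a = W̄` and `b = W` and treat them as independent complex vectors. All statements hold for
every matrix `H` with entries smaller than `1 / N`; neither Hermitian matrices nor analytic
continuation in `H` are needed.

*Convergence.* By the Cauchy–Schwarz inequality `|H_{m,n}|²` is at most `C m! n! ρ^(m+n)` for every
`ρ > 1`, uniformly for bounded arguments (`norm_complexHermite_sq_le`). Hence the product of the
Hermite polynomials in the term of index `K` is at most a constant times `ρ^(2|K|)` times the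
geometric mean of `∏ r_j!` and `∏ c_j!`, hence times their sum. The series of
`x^|K| ∏ r_j! / ∏ k_{m,n}!` is a product over the rows of `K`, and by the multinomial theorem each
factor is the geometric series `∑ (N x)^d`. This gives a summable majorant
(`exists_summable_bound`), also when the Hermite indices are shifted by constants.

*Value of the sum.* Let `S(H)` be the sum, and `S_{l,m}(H)` the sum in which the row index `r_l` and
the column index `c_m` of the Hermite polynomials are raised by one. Termwise differentiation gives
`d/dt S(tH) = ∑ h_{l,m} S_{l,m}(tH)` (`hasDerivAt_shiftedSum`). The recurrence
`H_{m+1,n} = z₁ H_{m,n} - n H_{m,n-1}`, summed over `K`, yields linear systems with matrix `1 + tH`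
for the shifted sums (`shiftedSum_add_single_left`); solving them (`sum_mul_shiftedSum`) shows that
the logarithmic derivative of `S(tH)` is
`aᵀ (1 + tH)⁻¹ H (1 + tH)⁻¹ b - tr ((1 + tH)⁻¹ H)`. This is also the logarithmic derivative of
`det (1 + tH)⁻¹ exp (aᵀ tH (1 + tH)⁻¹ b)`, and both functions are `1` at `t = 0`
(`shiftedSum_eq`).
-/

/-! ### Recurrence and growth of the complex Hermite polynomials -/

lemma complexHermite_comm (m n : ℕ) (z₁ z₂ : ℂ) :
    complexHermite m n z₁ z₂ = complexHermite n m z₂ z₁ := by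
  unfold complexHermite
  rw [min_comm]
  exact Finset.sum_congr rfl fun k _ => by ring

/-- The terms with `n < k` vanish, so the sum may run over all `k ≤ m`. -/
lemma complexHermite_eq_sum_range (m n : ℕ) (z₁ z₂ : ℂ) :
    complexHermite m n z₁ z₂ = ∑ k ∈ Finset.range (m + 1),
      (-1 : ℂ) ^ k * (k ! : ℂ) * (m.choose k : ℂ) * (n.choose k : ℂ) *
        z₁ ^ (m - k) * z₂ ^ (n - k) := by
  refine Finset.sum_subset (fun k hk => ?_) fun k hk hk' => ?_
  · simp only [Finset.mem_range] at *
    omega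
  · simp only [Finset.mem_range] at *
    rw [Nat.choose_eq_zero_of_lt (show n < k by omega)]
    simp

@[simp]
lemma complexHermite_zero_zero (z₁ z₂ : ℂ) : complexHermite 0 0 z₁ z₂ = 1 := by
  simp [complexHermite]

lemma complexHermite_succ_left (m n : ℕ) (z₁ z₂ : ℂ) :
    complexHermite (m + 1) n z₁ z₂ =
      z₁ * complexHermite m n z₁ z₂ - n * complexHermite m (n - 1) z₁ z₂ := by
  have key : ∀ k ∈ Finset.range (m + 1),
      (-1 : ℂ) ^ (k + 1) * ((k + 1)! : ℂ) * ((m + 1).choose (k + 1) : ℂ) *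
          (n.choose (k + 1) : ℂ) * z₁ ^ (m + 1 - (k + 1)) * z₂ ^ (n - (k + 1)) =
        (-1 : ℂ) ^ (k + 1) * ((k + 1)! : ℂ) * (m.choose (k + 1) : ℂ) *
          (n.choose (k + 1) : ℂ) * z₁ ^ (m + 1 - (k + 1)) * z₂ ^ (n - (k + 1)) -
        n * ((-1 : ℂ) ^ k * (k ! : ℂ) * (m.choose k : ℂ) * ((n - 1).choose k : ℂ) *
          z₁ ^ (m - k) * z₂ ^ (n - 1 - k)) := by
    intro k _
    have h : ((k : ℂ) + 1) * (n.choose (k + 1) : ℂ) = n * ((n - 1).choose k : ℂ) := by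
      rcases n with _ | n
      · simp
      · have := Nat.add_one_mul_choose_eq n k
        simp only [Nat.add_sub_cancel]
        rw [mul_comm]
        exact_mod_cast this.symm
    rw [Nat.choose_succ_succ, Nat.factorial_succ, Nat.sub_sub, Nat.add_sub_add_right,
      add_comm 1 k]
    push_cast
    linear_combination (-1 : ℂ) ^ (k + 1) * (k ! : ℂ) * (m.choose k : ℂ) * z₁ ^ (m - k) *
      z₂ ^ (n - (k + 1)) * h
  have h0 : z₁ * complexHermite m n z₁ z₂ = ∑ k ∈ Finset.range (m + 1 + 1),
      (-1 : ℂ) ^ k * (k ! : ℂ) * (m.choose k : ℂ) * (n.choose k : ℂ) *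
        z₁ ^ (m + 1 - k) * z₂ ^ (n - k) := by
    rw [Finset.sum_range_succ, Nat.choose_succ_self, complexHermite_eq_sum_range, Finset.mul_sum]
    simp only [Nat.cast_zero, mul_zero, zero_mul, add_zero]
    refine Finset.sum_congr rfl fun k hk => ?_
    rw [Nat.succ_sub (Nat.lt_succ_iff.1 (Finset.mem_range.1 hk)), pow_succ]
    ring
  rw [h0, complexHermite_eq_sum_range (m + 1), complexHermite_eq_sum_range m (n - 1),
    Finset.sum_range_succ' _ (m + 1), Finset.sum_range_succ' _ (m + 1),
    Finset.sum_congr rfl key, Finset.sum_sub_distrib, ← Finset.mul_sum]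
  simp only [Nat.choose_zero_right]
  ring

/-- A single term of the binomial expansion of `(1 + (ρ - 1)) ^ m`. -/
lemma choose_mul_pow_le (m j : ℕ) {ρ : ℝ} (hρ : 1 < ρ) :
    (m.choose j : ℝ) * (ρ - 1) ^ j ≤ ρ ^ m := by
  have hε : 0 ≤ ρ - 1 := by linarith
  rcases lt_or_ge m j with h | h
  · rw [Nat.choose_eq_zero_of_lt h]
    simp only [Nat.cast_zero, zero_mul]
    positivity
  · have h1 : ρ ^ m = ∑ i ∈ Finset.range (m + 1), (ρ - 1) ^ i * 1 ^ (m - i) * (m.choose i : ℝ) := by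
      rw [← add_pow]
      ring
    rw [h1]
    have := Finset.single_le_sum (f := fun i => (ρ - 1) ^ i * 1 ^ (m - i) * (m.choose i : ℝ))
      (s := Finset.range (m + 1)) (fun i _ => by positivity)
      (Finset.mem_range.2 (Nat.lt_succ_of_le h))
    refine le_trans (le_of_eq ?_) this
    simp only [one_pow]
    ring

lemma factorial_add_le (p m : ℕ) {ρ : ℝ} (hρ : 1 < ρ) :
    ((m + p)! : ℝ) ≤ (p ! * (ρ / (ρ - 1)) ^ p) * (m ! * ρ ^ m) := by
  have hε : 0 < ρ - 1 := by linarith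
  have h1 := choose_mul_pow_le (m + p) p hρ
  have h2 : ((m + p)! : ℝ) = (m + p).choose p * p ! * m ! := by
    have := Nat.add_choose_mul_factorial_mul_factorial m p
    rw [← this]
    push_cast
    ring
  rw [← le_div_iff₀ (by positivity)] at h1
  calc ((m + p)! : ℝ) = (m + p).choose p * (p ! * m !) := by rw [h2]; ring
    _ ≤ (ρ ^ (m + p) / (ρ - 1) ^ p) * (p ! * m !) := by gcongr
    _ = _ := by rw [pow_add, div_pow]; ring

/-- The diagonal sums that bound `H_{m,n}` by the Cauchy–Schwarz inequality. They equal
`m! L_m(-x²)` for the Laguerre polynomial `L_m`, and so grow more slowly than `m! ρ^m`. -/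
lemma sum_factorial_mul_choose_sq_le (m : ℕ) {x R ρ : ℝ} (hx : 0 ≤ x) (hxR : x ≤ R)
    (hρ : 1 < ρ) :
    ∑ k ∈ Finset.range (m + 1), (k ! : ℝ) * (m.choose k : ℝ) ^ 2 * (x ^ (m - k)) ^ 2 ≤
      Real.exp (R ^ 2 / (ρ - 1)) * (m ! * ρ ^ m) := by
  have hε : 0 < ρ - 1 := by linarith
  have h1 : ∀ k ∈ Finset.range (m + 1),
      (k ! : ℝ) * (m.choose k : ℝ) ^ 2 * (x ^ (m - k)) ^ 2 ≤
        m ! * ρ ^ m * ((R ^ 2 / (ρ - 1)) ^ (m - k) / (m - k)!) := by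
    intro k hk
    have hk' : k ≤ m := Nat.lt_succ_iff.1 (Finset.mem_range.1 hk)
    have h2 : (m ! : ℝ) = m.choose k * k ! * (m - k)! := by
      exact_mod_cast (Nat.choose_mul_factorial_mul_factorial hk').symm
    have h3 := choose_mul_pow_le m (m - k) hρ
    rw [Nat.choose_symm hk', ← le_div_iff₀ (by positivity)] at h3
    calc (k ! : ℝ) * (m.choose k : ℝ) ^ 2 * (x ^ (m - k)) ^ 2
        = (m ! / (m - k)!) * (m.choose k : ℝ) * (x ^ 2) ^ (m - k) := by
          rw [h2, ← pow_mul, ← pow_mul, mul_comm 2]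
          field_simp
      _ ≤ (m ! / (m - k)!) * (ρ ^ m / (ρ - 1) ^ (m - k)) * (R ^ 2) ^ (m - k) := by gcongr
      _ = _ := by rw [div_pow]; field_simp
  refine (Finset.sum_le_sum h1).trans ?_
  rw [← Finset.mul_sum, mul_comm (Real.exp _)]
  have h4 := Finset.sum_range_reflect (fun j => (R ^ 2 / (ρ - 1)) ^ j / (j ! : ℝ)) (m + 1)
  simp only [Nat.add_sub_cancel] at h4
  rw [h4]
  gcongr
  exact Real.sum_le_exp_of_nonneg (by positivity) _

lemma norm_complexHermite_sq_le (m n : ℕ) {z₁ z₂ : ℂ} {R ρ : ℝ} (h₁ : ‖z₁‖ ≤ R) (h₂ : ‖z₂‖ ≤ R)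
    (hρ : 1 < ρ) :
    ‖complexHermite m n z₁ z₂‖ ^ 2 ≤
      (Real.exp (R ^ 2 / (ρ - 1)) * (m ! * ρ ^ m)) *
        (Real.exp (R ^ 2 / (ρ - 1)) * (n ! * ρ ^ n)) := by
  have hA : ∀ (j l : ℕ) (z : ℂ), ‖z‖ ≤ R →
      ∑ k ∈ Finset.range (min j l + 1), (k ! : ℝ) * (j.choose k : ℝ) ^ 2 * (‖z‖ ^ (j - k)) ^ 2 ≤
        Real.exp (R ^ 2 / (ρ - 1)) * (j ! * ρ ^ j) := fun j l z hz =>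
    (Finset.sum_le_sum_of_subset_of_nonneg
      (Finset.range_subset_range.2 (Nat.succ_le_succ (min_le_left j l)))
      fun _ _ _ => by positivity).trans (sum_factorial_mul_choose_sq_le j (norm_nonneg z) hz hρ)
  calc ‖complexHermite m n z₁ z₂‖ ^ 2
      ≤ (∑ k ∈ Finset.range (min m n + 1),
          (k ! : ℝ) * m.choose k * n.choose k * ‖z₁‖ ^ (m - k) * ‖z₂‖ ^ (n - k)) ^ 2 := by
        gcongr
        refine (norm_sum_le _ _).trans (le_of_eq (Finset.sum_congr rfl fun k _ => ?_))
        simp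
    _ ≤ (∑ k ∈ Finset.range (min m n + 1),
            (k ! : ℝ) * (m.choose k : ℝ) ^ 2 * (‖z₁‖ ^ (m - k)) ^ 2) *
          ∑ k ∈ Finset.range (min m n + 1),
            (k ! : ℝ) * (n.choose k : ℝ) ^ 2 * (‖z₂‖ ^ (n - k)) ^ 2 :=
        Finset.sum_sq_le_sum_mul_sum_of_sq_le_mul _ (fun _ _ => by positivity)
          (fun _ _ => by positivity) fun _ _ => le_of_eq (by ring)
    _ ≤ _ := by
        refine mul_le_mul (hA m n z₁ h₁) ?_ (Finset.sum_nonneg fun _ _ => by positivity)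
          (by positivity)
        rw [min_comm]
        exact hA n m z₂ h₂

/-- Shifting the indices of `H_{m,n}` by constants costs only a constant factor. -/
lemma exists_norm_complexHermite_add_sq_le (p q : ℕ) (R : ℝ) {ρ : ℝ} (hρ : 1 < ρ) :
    ∃ C : ℝ, 0 ≤ C ∧ ∀ (m n : ℕ) (z₁ z₂ : ℂ), ‖z₁‖ ≤ R → ‖z₂‖ ≤ R →
      ‖complexHermite (m + p) (n + q) z₁ z₂‖ ^ 2 ≤
        C * ((m ! * (ρ ^ 2) ^ m) * (n ! * (ρ ^ 2) ^ n)) := by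
  have hε : 0 < ρ - 1 := by linarith
  have hρ0 : 0 < ρ := by linarith
  set E := Real.exp (R ^ 2 / (ρ - 1)) with hE
  refine ⟨(E * (p ! * (ρ / (ρ - 1)) ^ p * ρ ^ p)) * (E * (q ! * (ρ / (ρ - 1)) ^ q * ρ ^ q)),
    by positivity, fun m n z₁ z₂ h₁ h₂ => ?_⟩
  refine (norm_complexHermite_sq_le (m + p) (n + q) h₁ h₂ hρ).trans ?_
  have hA : ∀ j l : ℕ, E * ((j + l)! * ρ ^ (j + l)) ≤
      (E * (l ! * (ρ / (ρ - 1)) ^ l * ρ ^ l)) * (j ! * (ρ ^ 2) ^ j) := by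
    intro j l
    calc E * ((j + l)! * ρ ^ (j + l))
        ≤ E * ((l ! * (ρ / (ρ - 1)) ^ l * (j ! * ρ ^ j)) * ρ ^ (j + l)) := by
          gcongr
          exact factorial_add_le l j hρ
      _ = _ := by rw [pow_add, ← pow_mul, mul_comm 2 j, pow_mul, sq (ρ ^ j)]; ring
  calc _ ≤ _ := mul_le_mul (hA m p) (hA n q) (by positivity) (by positivity)
    _ = _ := by ring

/-! ### A summable majorant -/

/-- Grouping the vectors `v` by their total degree, the multinomial theorem turns the series into
the geometric series of ratio `card ι * x`. -/
lemma summable_factorial_sum_mul_prod {ι : Type*} [Fintype ι] {x : ℝ}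
    (hx : 0 ≤ x) (hx1 : Fintype.card ι * x < 1) :
    Summable fun v : ι → ℕ => ((∑ i, v i)! : ℝ) * ∏ i, x ^ v i / ((v i)! : ℝ) := by
  classical
  have hnn : ∀ v : ι → ℕ, 0 ≤ ((∑ i, v i)! : ℝ) * ∏ i, x ^ v i / ((v i)! : ℝ) :=
    fun v => mul_nonneg (by positivity) (Finset.prod_nonneg fun i _ => by positivity)
  have hgeom := summable_geometric_of_lt_one (r := Fintype.card ι * x) (by positivity) hx1
  refine summable_of_sum_le (c := ∑' d : ℕ, (Fintype.card ι * x) ^ d) hnn fun A => ?_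
  rw [← Finset.sum_fiberwise_of_maps_to (t := A.image fun v => ∑ i, v i)
    fun v hv => Finset.mem_image_of_mem _ hv]
  refine (Finset.sum_le_sum fun d _ => ?_).trans
    (hgeom.sum_le_tsum _ fun d _ => by positivity)
  calc ∑ v ∈ A with ∑ i, v i = d, ((∑ i, v i)! : ℝ) * ∏ i, x ^ v i / ((v i)! : ℝ)
      ≤ ∑ v ∈ Finset.piAntidiag Finset.univ d,
          ((∑ i, v i)! : ℝ) * ∏ i, x ^ v i / ((v i)! : ℝ) := by
        refine Finset.sum_le_sum_of_subset_of_nonneg (fun v hv => ?_) fun v _ _ => hnn v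
        simpa using (Finset.mem_filter.1 hv).2
    _ = (∑ _i : ι, x) ^ d := by
        rw [Finset.sum_pow_eq_sum_piAntidiag]
        refine Finset.sum_congr rfl fun v _ => ?_
        have h : ((∑ i, v i)! : ℝ) =
            (∏ i, ((v i)! : ℝ)) * (Nat.multinomial Finset.univ v : ℝ) := by
          exact_mod_cast (Nat.multinomial_spec Finset.univ v).symm
        have h' : (∏ i, ((v i)! : ℝ)) ≠ 0 := Finset.prod_ne_zero_iff.2 fun i _ => by positivity
        rw [h, Finset.prod_div_distrib]
        field_simp
    _ = (Fintype.card ι * x) ^ d := by simp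

lemma Summable.prod_pi {ι κ : Type*} [Fintype ι] {f : κ → ℝ} (hf : Summable f)
    (hnn : ∀ v, 0 ≤ f v) : Summable fun K : ι → κ => ∏ i, f (K i) := by
  classical
  refine summable_of_sum_le (c := ∏ _i : ι, ∑' v, f v)
    (fun K => Finset.prod_nonneg fun i _ => hnn _) fun A => ?_
  calc ∑ K ∈ A, ∏ i, f (K i)
      ≤ ∑ K ∈ Fintype.piFinset fun i => A.image fun K => K i, ∏ i, f (K i) :=
        Finset.sum_le_sum_of_subset_of_nonneg
          (fun K hK => Fintype.mem_piFinset.2 fun i => Finset.mem_image_of_mem _ hK)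
          fun K _ _ => Finset.prod_nonneg fun i _ => hnn _
    _ = ∏ i, ∑ v ∈ A.image fun K => K i, f v := (Finset.prod_univ_sum _ _).symm
    _ ≤ _ := Finset.prod_le_prod (fun i _ => Finset.sum_nonneg fun v _ => hnn v)
        fun i _ => hf.sum_le_tsum _ fun v _ => hnn v

variable {N : ℕ}

lemma colTotal_eq_rowTotal_transpose (K : Matrix (Fin N) (Fin N) ℕ) (j : Fin N) :
    colTotal K j = rowTotal Kᵀ j := rfl

lemma summable_prod_rowTotal_factorial {x : ℝ} (hx : 0 ≤ x) (hx1 : N * x < 1) :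
    Summable fun K : Matrix (Fin N) (Fin N) ℕ =>
      (∏ j, ((rowTotal K j)! : ℝ)) * ∏ m, ∏ n, x ^ K m n / ((K m n)! : ℝ) := by
  have h := (summable_factorial_sum_mul_prod (ι := Fin N) hx (by simpa using hx1)).prod_pi
    (ι := Fin N) fun v => mul_nonneg (by positivity) (Finset.prod_nonneg fun i _ => by positivity)
  refine h.congr fun K => ?_
  rw [Finset.prod_mul_distrib]
  rfl

/-- The majorant of the multilinear series: `x` bounds the entries of the matrix up to a factor
close to `1`. -/
noncomputable def majorant (x : ℝ) (K : Matrix (Fin N) (Fin N) ℕ) : ℝ :=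
  ((∏ j, ((rowTotal K j)! : ℝ)) + ∏ j, ((colTotal K j)! : ℝ)) *
    ∏ m, ∏ n, x ^ K m n / ((K m n)! : ℝ)

lemma summable_majorant {x : ℝ} (hx : 0 ≤ x) (hx1 : N * x < 1) :
    Summable (majorant x : Matrix (Fin N) (Fin N) ℕ → ℝ) := by
  have h := summable_prod_rowTotal_factorial hx hx1
  have h' := (Matrix.transposeAddEquiv (Fin N) (Fin N) ℕ).toEquiv.summable_iff.2 h
  refine (h.add h').congr fun K => ?_
  have : ∏ m, ∏ n, x ^ K m n / ((K m n)! : ℝ) = ∏ m, ∏ n, x ^ K n m / ((K n m)! : ℝ) :=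
    Finset.prod_comm
  simp only [majorant, add_mul, Function.comp]
  congr 1
  rw [this]
  rfl

/-- The coefficient `∏_{m,n} h_{m,n}^{k_{m,n}} / k_{m,n}!`. -/
noncomputable def expCoeff (H : Matrix (Fin N) (Fin N) ℂ) (K : Matrix (Fin N) (Fin N) ℕ) : ℂ :=
  ∏ m, ∏ n, H m n ^ K m n / ((K m n)! : ℂ)

/-- The product `∏_j H_{μ_j, ν_j}(a_j, b_j)` of complex Hermite polynomials. The arguments `a` and
`b` are independent complex vectors, which makes the roles of rows and columns symmetric. -/
noncomputable def hermiteProd (a b : Fin N → ℂ) (μ ν : Fin N → ℕ) : ℂ :=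
  ∏ j, complexHermite (μ j) (ν j) (a j) (b j)

/-- The term of the multilinear series in which the row sums of `K` are shifted by `p` and the
column sums by `q`. -/
noncomputable def shiftedTerm (H : Matrix (Fin N) (Fin N) ℂ) (a b : Fin N → ℂ) (p q : Fin N → ℕ)
    (K : Matrix (Fin N) (Fin N) ℕ) : ℂ :=
  expCoeff H K * hermiteProd a b (rowTotal K + p) (colTotal K + q)

lemma norm_expCoeff_le {H : Matrix (Fin N) (Fin N) ℂ} {s : ℝ} (hH : ∀ m n, ‖H m n‖ ≤ s)
    (K : Matrix (Fin N) (Fin N) ℕ) :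
    ‖expCoeff H K‖ ≤ ∏ m, ∏ n, s ^ K m n / ((K m n)! : ℝ) := by
  unfold expCoeff
  rw [norm_prod]
  refine Finset.prod_le_prod (fun _ _ => norm_nonneg _) fun m _ => ?_
  rw [norm_prod]
  refine Finset.prod_le_prod (fun _ _ => norm_nonneg _) fun n _ => ?_
  rw [norm_div, norm_pow, Complex.norm_natCast]
  gcongr
  exact hH m n

/-- The bound for the product of Hermite polynomials is the geometric mean of a product over rows
and a product over columns; bounding it by the sum of the two separates them. -/
lemma exists_norm_hermiteProd_le (p q : Fin N → ℕ) (R : ℝ) {ρ : ℝ} (hρ : 1 < ρ) :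
    ∃ D : ℝ, 0 ≤ D ∧ ∀ (K : Matrix (Fin N) (Fin N) ℕ) (a b : Fin N → ℂ),
      (∀ j, ‖a j‖ ≤ R) → (∀ j, ‖b j‖ ≤ R) →
      ‖hermiteProd a b (rowTotal K + p) (colTotal K + q)‖ ≤
        D * (((∏ j, ((rowTotal K j)! : ℝ)) + ∏ j, ((colTotal K j)! : ℝ)) *
          ∏ m, ∏ n, (ρ ^ 2) ^ K m n) := by
  choose C hC0 hC using fun j => exists_norm_complexHermite_add_sq_le (p j) (q j) R hρ
  have hC1 : 0 ≤ ∏ j, C j := Finset.prod_nonneg fun j _ => hC0 j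
  refine ⟨1 + ∏ j, C j, by positivity, fun K a b ha hb => ?_⟩
  set A := ∏ j, ((rowTotal K j)! : ℝ) with hA
  set B := ∏ j, ((colTotal K j)! : ℝ) with hB
  set P := ∏ m, ∏ n, (ρ ^ 2) ^ K m n with hP
  have hA0 : 0 ≤ A := Finset.prod_nonneg fun _ _ => by positivity
  have hB0 : 0 ≤ B := Finset.prod_nonneg fun _ _ => by positivity
  have hP0 : 0 ≤ P := Finset.prod_nonneg fun _ _ => Finset.prod_nonneg fun _ _ => by positivity
  have hrow : ∏ j, (ρ ^ 2) ^ rowTotal K j = P := by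
    simp only [rowTotal, Finset.prod_pow_eq_pow_sum, hP]
  have hcol : ∏ j, (ρ ^ 2) ^ colTotal K j = P := by
    rw [hP, Finset.prod_comm]
    simp only [colTotal, Finset.prod_pow_eq_pow_sum]
  have h : ‖hermiteProd a b (rowTotal K + p) (colTotal K + q)‖ ^ 2 ≤ (∏ j, C j) * ((A * P) * (B * P)) := by
    unfold hermiteProd
    rw [norm_prod, ← Finset.prod_pow]
    refine (Finset.prod_le_prod (fun _ _ => by positivity)
      fun j _ => hC j (rowTotal K j) (colTotal K j) (a j) (b j) (ha j) (hb j)).trans (le_of_eq ?_)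
    simp only [Finset.prod_mul_distrib, hrow, hcol, ← hA, ← hB]
  refine le_of_sq_le_sq (h.trans ?_) (by positivity)
  have h1 : (A * P) * (B * P) ≤ ((A + B) * P) ^ 2 := by
    nlinarith [mul_nonneg hA0 hB0, mul_nonneg hP0 hP0,
      mul_nonneg (mul_nonneg hP0 hP0) (mul_nonneg hA0 hB0), sq_nonneg (A * P), sq_nonneg (B * P)]
  calc (∏ j, C j) * ((A * P) * (B * P)) ≤ (1 + ∏ j, C j) ^ 2 * ((A + B) * P) ^ 2 :=
        mul_le_mul (by nlinarith) h1 (by positivity) (by positivity)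
    _ = _ := by ring

/-- The M-test bound: on matrices with entries at most `s < 1 / N` in absolute value and on bounded
vectors, the (shifted) multilinear series has a summable majorant. -/
lemma exists_summable_bound (p q : Fin N → ℕ) (R : ℝ) {s : ℝ} (hs : 0 ≤ s) (hsN : N * s < 1) :
    ∃ u : Matrix (Fin N) (Fin N) ℕ → ℝ, Summable u ∧
      ∀ (K : Matrix (Fin N) (Fin N) ℕ) (H : Matrix (Fin N) (Fin N) ℂ) (a b : Fin N → ℂ),
        (∀ m n, ‖H m n‖ ≤ s) → (∀ j, ‖a j‖ ≤ R) → (∀ j, ‖b j‖ ≤ R) →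
        ‖shiftedTerm H a b p q K‖ ≤ u K := by
  -- With `ρ = 1 + δ` and `N s = 1 - 3 δ`, we get `N s ρ² = 1 - δ - 5 δ² - 3 δ³ < 1`.
  obtain ⟨δ, hδ⟩ : ∃ δ : ℝ, N * s = 1 - 3 * δ := ⟨(1 - N * s) / 3, by ring⟩
  have hδ0 : 0 < δ := by linarith
  obtain ⟨D, hD0, hD⟩ := exists_norm_hermiteProd_le p q R (ρ := 1 + δ) (by linarith)
  have hx : N * (s * (1 + δ) ^ 2) < 1 := by
    rw [← mul_assoc, hδ]
    nlinarith [pow_pos hδ0 2, pow_pos hδ0 3]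
  refine ⟨fun K => D * majorant (s * (1 + δ) ^ 2) K,
    (summable_majorant (by positivity) hx).mul_left D, fun K H a b hH ha hb => ?_⟩
  rw [shiftedTerm, norm_mul]
  refine (mul_le_mul (norm_expCoeff_le hH K) (hD K a b ha hb) (norm_nonneg _)
    (Finset.prod_nonneg fun _ _ => Finset.prod_nonneg fun _ _ => by positivity)).trans
    (le_of_eq ?_)
  have : ∏ m, ∏ n, (s * (1 + δ) ^ 2) ^ K m n / ((K m n)! : ℝ) =
      (∏ m, ∏ n, s ^ K m n / ((K m n)! : ℝ)) * ∏ m, ∏ n, ((1 + δ) ^ 2) ^ K m n := by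
    simp only [← Finset.prod_mul_distrib]
    refine Finset.prod_congr rfl fun m _ => Finset.prod_congr rfl fun n _ => ?_
    rw [mul_pow]
    ring
  simp only [majorant, this]
  ring

/-! ### Contiguity relations for the shifted series -/

lemma hermiteProd_comm (a b : Fin N → ℂ) (μ ν : Fin N → ℕ) :
    hermiteProd a b μ ν = hermiteProd b a ν μ :=
  Finset.prod_congr rfl fun _ _ => complexHermite_comm _ _ _ _

lemma hermiteProd_add_single (a b : Fin N → ℂ) (μ ν : Fin N → ℕ) (m : Fin N) :
    hermiteProd a b (μ + Pi.single m 1) ν =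
      a m * hermiteProd a b μ ν - ν m * hermiteProd a b μ (ν - Pi.single m 1) := by
  have h : ∀ μ ν : Fin N → ℕ, hermiteProd a b μ ν = complexHermite (μ m) (ν m) (a m) (b m) *
      ∏ j ∈ Finset.univ.erase m, complexHermite (μ j) (ν j) (a j) (b j) := fun μ ν =>
    (Finset.mul_prod_erase _ _ (Finset.mem_univ m)).symm
  have h1 : ∏ j ∈ Finset.univ.erase m,
        complexHermite ((μ + Pi.single m 1 : Fin N → ℕ) j) (ν j) (a j) (b j) =
      ∏ j ∈ Finset.univ.erase m, complexHermite (μ j) (ν j) (a j) (b j) :=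
    Finset.prod_congr rfl fun j hj => by simp [Pi.single_eq_of_ne (Finset.ne_of_mem_erase hj)]
  have h2 : ∏ j ∈ Finset.univ.erase m,
        complexHermite (μ j) ((ν - Pi.single m 1 : Fin N → ℕ) j) (a j) (b j) =
      ∏ j ∈ Finset.univ.erase m, complexHermite (μ j) (ν j) (a j) (b j) :=
    Finset.prod_congr rfl fun j hj => by simp [Pi.single_eq_of_ne (Finset.ne_of_mem_erase hj)]
  rw [h (μ + Pi.single m 1), h μ ν, h μ (ν - Pi.single m 1), h1, h2]
  simp only [Pi.add_apply, Pi.sub_apply, Pi.single_eq_same, complexHermite_succ_left]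
  ring

lemma rowTotal_add_single (K : Matrix (Fin N) (Fin N) ℕ) (l m : Fin N) :
    rowTotal (K + Matrix.single l m 1) = rowTotal K + Pi.single l 1 := by
  ext i
  simp only [rowTotal, Matrix.add_apply, Finset.sum_add_distrib, Pi.add_apply]
  congr 1
  by_cases h : l = i
  · subst h
    simp [Matrix.single_apply]
  · simp [h]

lemma colTotal_add_single (K : Matrix (Fin N) (Fin N) ℕ) (l m : Fin N) :
    colTotal (K + Matrix.single l m 1) = colTotal K + Pi.single m 1 := by
  have := rowTotal_add_single Kᵀ m l
  ext i
  rw [colTotal_eq_rowTotal_transpose, Matrix.transpose_add, Matrix.transpose_single, this]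
  rfl

lemma expCoeff_add_single (H : Matrix (Fin N) (Fin N) ℂ) (K : Matrix (Fin N) (Fin N) ℕ)
    (l m : Fin N) :
    ((K l m : ℂ) + 1) * expCoeff H (K + Matrix.single l m 1) = H l m * expCoeff H K := by
  have h : ∀ i j, H i j ^ (K + Matrix.single l m 1 : Matrix (Fin N) (Fin N) ℕ) i j /
      (((K + Matrix.single l m 1 : Matrix (Fin N) (Fin N) ℕ) i j)! : ℂ) =
      H i j ^ K i j / ((K i j)! : ℂ) *
        if l = i then (if m = j then H i j / ((K i j : ℂ) + 1) else 1) else 1 := by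
    intro i j
    by_cases hi : l = i
    · by_cases hj : m = j
      · subst hi hj
        have h1 : ((K l m : ℂ) + 1) ≠ 0 := Nat.cast_add_one_ne_zero _
        have h2 : ((K l m)! : ℂ) ≠ 0 := by exact_mod_cast (K l m).factorial_ne_zero
        simp only [Matrix.add_apply, Matrix.single_apply_same, Nat.factorial_succ, pow_succ,
          if_true]
        push_cast
        field_simp
      · simp [hi, hj]
    · simp [hi]
  have h1 : ((K l m : ℂ) + 1) ≠ 0 := Nat.cast_add_one_ne_zero _
  have h2 : ∏ i, ∏ j, (if l = i then (if m = j then H i j / ((K i j : ℂ) + 1) else 1) else 1) =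
      H l m / ((K l m : ℂ) + 1) := by
    rw [Finset.prod_eq_single l]
    · simp
    · intro i _ hi
      simp [hi.symm]
    · simp
  unfold expCoeff
  simp only [h, Finset.prod_mul_distrib, h2]
  field_simp

/-- Re-indexing of a series along `K ↦ K + E_{l,m}`. -/
lemma hasSum_of_hasSum_add_single {f : Matrix (Fin N) (Fin N) ℕ → ℂ} {s : ℂ} (l m : Fin N)
    (hf : ∀ K, K l m = 0 → f K = 0)
    (h : HasSum (fun K => f (K + Matrix.single l m 1)) s) : HasSum f s := by
  have hinj : Function.Injective
      fun K : Matrix (Fin N) (Fin N) ℕ => K + Matrix.single l m 1 := add_left_injective _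
  refine (hinj.hasSum_iff fun K hK => hf K ?_).1 h
  by_contra h0
  refine hK ⟨K - Matrix.single l m 1, ?_⟩
  ext i j
  simp only [Matrix.add_apply, Matrix.sub_apply, Matrix.single_apply]
  split_ifs with hij
  · obtain ⟨rfl, rfl⟩ := hij
    omega
  · simp

/-- The sum of the multilinear series whose Hermite indices are shifted by `p` and `q`. -/
noncomputable def shiftedSum (H : Matrix (Fin N) (Fin N) ℂ) (a b : Fin N → ℂ)
    (p q : Fin N → ℕ) : ℂ :=
  ∑' K, shiftedTerm H a b p q K

lemma summable_shiftedTerm {H : Matrix (Fin N) (Fin N) ℂ} {s : ℝ} (hs : 0 ≤ s) (hsN : N * s < 1)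
    (hH : ∀ m n, ‖H m n‖ ≤ s) (a b : Fin N → ℂ) (p q : Fin N → ℕ) :
    Summable (shiftedTerm H a b p q) := by
  obtain ⟨u, hu, hb⟩ := exists_summable_bound p q (‖a‖ + ‖b‖) hs hsN
  refine Summable.of_norm_bounded hu fun K => hb K H a b hH (fun j => ?_) fun j => ?_
  · exact (norm_le_pi_norm a j).trans (le_add_of_nonneg_right (norm_nonneg b))
  · exact (norm_le_pi_norm b j).trans (le_add_of_nonneg_left (norm_nonneg a))

lemma shiftedSum_transpose (H : Matrix (Fin N) (Fin N) ℂ) (a b : Fin N → ℂ) (p q : Fin N → ℕ) :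
    shiftedSum Hᵀ b a q p = shiftedSum H a b p q := by
  unfold shiftedSum
  rw [← (Matrix.transposeAddEquiv (Fin N) (Fin N) ℕ).toEquiv.tsum_eq]
  refine tsum_congr fun K => ?_
  have h : expCoeff Hᵀ Kᵀ = expCoeff H K := Finset.prod_comm
  change expCoeff Hᵀ Kᵀ * hermiteProd b a (rowTotal Kᵀ + q) (colTotal Kᵀ + p) = _
  rw [h, hermiteProd_comm]
  rfl

/-- The recurrence in the first Hermite index, summed over `K`: the factor `c_m`, the sum of column
`m`, is absorbed by re-indexing along `K ↦ K + E_{l,m}`. -/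
lemma shiftedSum_add_single_left {H : Matrix (Fin N) (Fin N) ℂ} {s : ℝ} (hs : 0 ≤ s)
    (hsN : N * s < 1) (hH : ∀ m n, ‖H m n‖ ≤ s) (a b : Fin N → ℂ) (p q : Fin N → ℕ)
    (m : Fin N) :
    shiftedSum H a b (p + Pi.single m 1) q =
      a m * shiftedSum H a b p q - q m * shiftedSum H a b p (q - Pi.single m 1) -
        ∑ l, H l m * shiftedSum H a b (p + Pi.single l 1) q := by
  have hS := fun p q => (summable_shiftedTerm hs hsN hH a b p q).hasSum
  have hψ : ∀ l, HasSum (fun K => (K l m : ℂ) * (expCoeff H K *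
      hermiteProd a b (rowTotal K + p) (colTotal K + q - Pi.single m 1)))
      (H l m * shiftedSum H a b (p + Pi.single l 1) q) := by
    intro l
    refine hasSum_of_hasSum_add_single l m (fun K hK => by simp [hK]) ?_
    refine ((hS (p + Pi.single l 1) q).mul_left (H l m)).congr_fun ?_
    intro K
    have h1 : colTotal K + Pi.single m 1 + q - Pi.single m 1 = colTotal K + q := by
      ext j
      simp only [Pi.add_apply, Pi.sub_apply]
      omega
    have h2 := expCoeff_add_single H K l m
    rw [rowTotal_add_single, colTotal_add_single, h1, shiftedTerm, add_right_comm, add_assoc]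
    simp only [Matrix.add_apply, Matrix.single_apply_same]
    push_cast
    linear_combination hermiteProd a b (rowTotal K + (p + Pi.single l 1)) (colTotal K + q) * h2
  refine (hS (p + Pi.single m 1) q).unique ?_
  refine ((((hS p q).mul_left (a m)).sub ((hS p (q - Pi.single m 1)).mul_left (q m : ℂ))).sub
    (hasSum_sum fun l (_ : l ∈ Finset.univ) => hψ l)).congr_fun ?_
  intro K
  have h1 : (q m : ℂ) * hermiteProd a b (rowTotal K + p) (colTotal K + (q - Pi.single m 1)) =
      q m * hermiteProd a b (rowTotal K + p) (colTotal K + q - Pi.single m 1) := by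
    rcases Nat.eq_zero_or_pos (q m) with h | h
    · simp [h]
    · congr 2
      ext j
      simp only [Pi.add_apply, Pi.sub_apply]
      by_cases hj : j = m
      · subst hj
        simp only [Pi.single_eq_same]
        omega
      · simp [Pi.single_eq_of_ne hj]
  rw [← Finset.sum_mul, ← Nat.cast_sum]
  change _ = _ - _ - (colTotal K m : ℂ) * _
  simp only [shiftedTerm]
  rw [← add_assoc, hermiteProd_add_single]
  simp only [Pi.add_apply]
  push_cast
  linear_combination expCoeff H K * h1

lemma shiftedSum_add_single_right {H : Matrix (Fin N) (Fin N) ℂ} {s : ℝ} (hs : 0 ≤ s)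
    (hsN : N * s < 1) (hH : ∀ m n, ‖H m n‖ ≤ s) (a b : Fin N → ℂ) (p q : Fin N → ℕ)
    (n : Fin N) :
    shiftedSum H a b p (q + Pi.single n 1) =
      b n * shiftedSum H a b p q - p n * shiftedSum H a b (p - Pi.single n 1) q -
        ∑ l, H n l * shiftedSum H a b p (q + Pi.single l 1) := by
  have h := shiftedSum_add_single_left (H := Hᵀ) hs hsN (fun i j => hH j i) b a q p n
  simpa only [shiftedSum_transpose, Matrix.transpose_apply] using h

/-! ### The logarithmic derivative of the series -/

/-- The linear system satisfied by the sums with one shifted column index. -/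
lemma one_add_mulVec_shiftedSum {H : Matrix (Fin N) (Fin N) ℂ} {s : ℝ} (hs : 0 ≤ s)
    (hsN : N * s < 1) (hH : ∀ m n, ‖H m n‖ ≤ s) (a b : Fin N → ℂ) :
    (1 + H) *ᵥ (fun n => shiftedSum H a b 0 (Pi.single n 1)) = shiftedSum H a b 0 0 • b := by
  ext n
  have h := shiftedSum_add_single_right hs hsN hH a b 0 0 n
  simp only [zero_add, Pi.zero_apply, Nat.cast_zero, zero_mul, sub_zero] at h
  rw [Matrix.add_mulVec, Matrix.one_mulVec]
  simp only [Pi.add_apply, Matrix.mulVec, dotProduct, Pi.smul_apply, smul_eq_mul]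
  linear_combination h

/-- The linear system satisfied by the sums with one shifted row and one shifted column index. -/
lemma one_add_transpose_mul_shiftedSum {H : Matrix (Fin N) (Fin N) ℂ} {s : ℝ} (hs : 0 ≤ s)
    (hsN : N * s < 1) (hH : ∀ m n, ‖H m n‖ ≤ s) (a b : Fin N → ℂ) :
    (1 + H)ᵀ * Matrix.of (fun m n => shiftedSum H a b (Pi.single m 1) (Pi.single n 1)) =
      Matrix.vecMulVec a (fun n => shiftedSum H a b 0 (Pi.single n 1)) -
        shiftedSum H a b 0 0 • (1 : Matrix (Fin N) (Fin N) ℂ) := by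
  ext m n
  have h := shiftedSum_add_single_left hs hsN hH a b 0 (Pi.single n 1) m
  have h1 : ((Pi.single n 1 : Fin N → ℕ) m : ℂ) *
      shiftedSum H a b 0 (Pi.single n 1 - Pi.single m 1) =
      shiftedSum H a b 0 0 * (1 : Matrix (Fin N) (Fin N) ℂ) m n := by
    by_cases hmn : m = n
    · subst hmn
      simp
    · simp [Pi.single_eq_of_ne hmn, Matrix.one_apply_ne hmn]
  rw [h1] at h
  simp only [zero_add] at h
  rw [Matrix.transpose_add, Matrix.transpose_one, add_mul, one_mul]
  simp only [Matrix.add_apply, Matrix.mul_apply, Matrix.of_apply, Matrix.sub_apply,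
    Matrix.vecMulVec_apply, Matrix.smul_apply, smul_eq_mul, Matrix.transpose_apply]
  linear_combination h

/-- Solving the two linear systems expresses the contraction of the doubly shifted sums with a
matrix `X` through the unshifted sum. -/
lemma sum_mul_shiftedSum {H : Matrix (Fin N) (Fin N) ℂ} {s : ℝ} (hs : 0 ≤ s)
    (hsN : N * s < 1) (hH : ∀ m n, ‖H m n‖ ≤ s) (hdet : IsUnit (1 + H).det) (a b : Fin N → ℂ)
    (X : Matrix (Fin N) (Fin N) ℂ) :
    ∑ l, ∑ m, X l m * shiftedSum H a b (Pi.single l 1) (Pi.single m 1) =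
      shiftedSum H a b 0 0 *
        (a ⬝ᵥ (((1 + H)⁻¹ * X * (1 + H)⁻¹) *ᵥ b) - ((1 + H)⁻¹ * X).trace) := by
  set A := 1 + H with hA
  set S := shiftedSum H a b 0 0 with hS
  have hβ := one_add_mulVec_shiftedSum hs hsN hH a b
  have hΓ := one_add_transpose_mul_shiftedSum hs hsN hH a b
  rw [← hA, ← hS] at hβ hΓ
  set β : Fin N → ℂ := fun n => shiftedSum H a b 0 (Pi.single n 1)
  set Γ : Matrix (Fin N) (Fin N) ℂ :=
    Matrix.of fun m n => shiftedSum H a b (Pi.single m 1) (Pi.single n 1) with hΓdef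
  have hβ' : β = S • (A⁻¹ *ᵥ b) := by
    rw [← Matrix.mulVec_smul, ← hβ, Matrix.mulVec_mulVec, Matrix.nonsing_inv_mul _ hdet,
      Matrix.one_mulVec]
  have hΓ' : Γ = (A⁻¹)ᵀ * (Matrix.vecMulVec a β - S • (1 : Matrix (Fin N) (Fin N) ℂ)) := by
    rw [← hΓ, ← Matrix.mul_assoc, ← Matrix.transpose_mul, Matrix.mul_nonsing_inv _ hdet,
      Matrix.transpose_one, Matrix.one_mul]
  have hlhs : ∑ l, ∑ m, X l m * shiftedSum H a b (Pi.single l 1) (Pi.single m 1) =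
      (Xᵀ * Γ).trace := by
    simp only [Matrix.trace, Matrix.diag_apply, Matrix.mul_apply, Matrix.transpose_apply]
    rw [Finset.sum_comm]
    rfl
  rw [hlhs, hΓ', ← Matrix.mul_assoc, ← Matrix.transpose_mul, Matrix.mul_sub, Matrix.trace_sub,
    Matrix.mul_smul, Matrix.mul_one, Matrix.trace_smul, Matrix.trace_transpose,
    Matrix.mul_vecMulVec, Matrix.trace_vecMulVec, Matrix.mulVec_transpose,
    ← Matrix.dotProduct_mulVec, hβ', Matrix.mulVec_smul, Matrix.mulVec_mulVec, dotProduct_smul,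
    smul_eq_mul, smul_eq_mul]
  ring

lemma expCoeff_smul (t : ℂ) (H : Matrix (Fin N) (Fin N) ℂ) (K : Matrix (Fin N) (Fin N) ℕ) :
    expCoeff (t • H) K = t ^ (∑ l, ∑ m, K l m) * expCoeff H K := by
  simp only [expCoeff, ← Finset.prod_pow_eq_pow_sum, ← Finset.prod_mul_distrib,
    Matrix.smul_apply, smul_eq_mul, mul_pow, mul_div_assoc]

lemma sum_add_single (K : Matrix (Fin N) (Fin N) ℕ) (l m : Fin N) :
    ∑ i, ∑ j, (K + Matrix.single l m 1 : Matrix (Fin N) (Fin N) ℕ) i j =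
      ∑ i, ∑ j, K i j + 1 := by
  have h : ∀ i, ∑ j, (K + Matrix.single l m 1 : Matrix (Fin N) (Fin N) ℕ) i j =
      rowTotal K i + (Pi.single l 1 : Fin N → ℕ) i :=
    fun i => congrFun (rowTotal_add_single K l m) i
  simp only [h, Finset.sum_add_distrib, rowTotal]
  simp

lemma norm_smul_apply_le {H : Matrix (Fin N) (Fin N) ℂ} {s τ : ℝ} (hH : ∀ m n, ‖H m n‖ ≤ s)
    {t : ℂ} (ht : t ∈ Metric.ball (0 : ℂ) τ) (m n : Fin N) : ‖(t • H) m n‖ ≤ τ * s := by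
  rw [mem_ball_zero_iff] at ht
  rw [Matrix.smul_apply, norm_smul]
  exact mul_le_mul ht.le (hH m n) (norm_nonneg _) ((norm_nonneg t).trans ht.le)

/-- Along the ray `t • H` the series may be differentiated termwise; the factors `k_{l,m}` that
appear are absorbed by re-indexing along `K ↦ K + E_{l,m}`. -/
lemma hasDerivAt_shiftedSum {H : Matrix (Fin N) (Fin N) ℂ} {s τ : ℝ} (hs : 0 ≤ s) (hτ : 0 ≤ τ)
    (hsN : N * (τ * s) < 1) (hH : ∀ m n, ‖H m n‖ ≤ s) (a b : Fin N → ℂ) {t : ℂ}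
    (ht : t ∈ Metric.ball (0 : ℂ) τ) :
    HasDerivAt (fun t : ℂ => shiftedSum (t • H) a b 0 0)
      (∑ l, ∑ m, H l m * shiftedSum (t • H) a b (Pi.single l 1) (Pi.single m 1)) t := by
  obtain ⟨u, hu, hub⟩ := exists_summable_bound (N := N) 0 0 (‖a‖ + ‖b‖) (mul_nonneg hτ hs) hsN
  have hbound : ∀ (K : Matrix (Fin N) (Fin N) ℕ) (w : ℂ), w ∈ Metric.ball (0 : ℂ) τ →
      ‖shiftedTerm (w • H) a b 0 0 K‖ ≤ u K := fun K w hw =>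
    hub K _ a b (norm_smul_apply_le hH hw)
      (fun j => (norm_le_pi_norm a j).trans (le_add_of_nonneg_right (norm_nonneg b)))
      (fun j => (norm_le_pi_norm b j).trans (le_add_of_nonneg_left (norm_nonneg a)))
  have hderiv : ∀ (K : Matrix (Fin N) (Fin N) ℕ) (w : ℂ),
      HasDerivAt (fun w : ℂ => shiftedTerm (w • H) a b 0 0 K)
        (∑ l, ∑ m, (K l m : ℂ) * (w ^ (∑ l, ∑ m, K l m - 1) * expCoeff H K *
          hermiteProd a b (rowTotal K) (colTotal K))) w := by
    intro K w
    have h := ((hasDerivAt_pow (∑ l, ∑ m, K l m) w).mul_const (expCoeff H K)).mul_const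
      (hermiteProd a b (rowTotal K + 0) (colTotal K + 0))
    simp only [shiftedTerm, expCoeff_smul]
    refine h.congr_deriv ?_
    simp only [← Finset.sum_mul, add_zero]
    push_cast
    ring
  have hdiff : ∀ K : Matrix (Fin N) (Fin N) ℕ,
      DifferentiableOn ℂ (fun w : ℂ => shiftedTerm (w • H) a b 0 0 K) (Metric.ball 0 τ) :=
    fun K w _ => (hderiv K w).differentiableAt.differentiableWithinAt
  have h1 := Complex.hasSum_deriv_of_summable_norm hu hdiff Metric.isOpen_ball hbound ht
  have h2 : DifferentiableAt ℂ (fun t : ℂ => shiftedSum (t • H) a b 0 0) t :=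
    (Complex.differentiableOn_tsum_of_summable_norm hu hdiff Metric.isOpen_ball
      hbound).differentiableAt (Metric.isOpen_ball.mem_nhds ht)
  have h3 : HasSum (fun K => deriv (fun w : ℂ => shiftedTerm (w • H) a b 0 0 K) t)
      (∑ l, ∑ m, H l m * shiftedSum (t • H) a b (Pi.single l 1) (Pi.single m 1)) := by
    simp only [(hderiv _ t).deriv]
    refine hasSum_sum fun l _ => hasSum_sum fun m _ => ?_
    refine hasSum_of_hasSum_add_single l m (fun K hK => by simp [hK]) ?_
    refine ((summable_shiftedTerm (mul_nonneg hτ hs) hsN (norm_smul_apply_le hH ht) a b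
      (Pi.single l 1) (Pi.single m 1)).hasSum.mul_left (H l m)).congr_fun ?_
    intro K
    have h2 := expCoeff_add_single H K l m
    rw [rowTotal_add_single, colTotal_add_single, sum_add_single, Nat.add_sub_cancel, shiftedTerm,
      expCoeff_smul]
    simp only [Matrix.add_apply, Matrix.single_apply_same]
    push_cast
    linear_combination t ^ (∑ l, ∑ m, K l m) *
      hermiteProd a b (rowTotal K + Pi.single l 1) (colTotal K + Pi.single m 1) * h2
  rw [h3.unique h1]
  exact h2.hasDerivAt

/-! ### The closed form -/

/-- Jacobi's formula along a ray, from the expansion of `det (1 + r • M)` at `r = 0`. -/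
lemma hasDerivAt_det_one_add_smul (H : Matrix (Fin N) (Fin N) ℂ) {t : ℂ}
    (ht : IsUnit (1 + t • H).det) :
    HasDerivAt (fun t : ℂ => (1 + t • H).det)
      ((1 + t • H).det * ((1 + t • H)⁻¹ * H).trace) t := by
  set A := 1 + t • H with hA
  set M := A⁻¹ * H with hM
  have h1 : ∀ w : ℂ, (1 + w • H).det = A.det * (1 + M.trace * (w - t) +
      (Polynomial.eval (w - t)
        (1 + (Polynomial.X : Polynomial ℂ) • M.map Polynomial.C).det.divX.divX) *
        (w - t) ^ 2) := by
    intro w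
    rw [← Matrix.det_one_add_smul, ← Matrix.det_mul]
    congr 1
    rw [hM, Matrix.mul_add, Matrix.mul_one, Matrix.mul_smul, ← Matrix.mul_assoc,
      Matrix.mul_nonsing_inv _ ht, Matrix.one_mul, hA, sub_smul]
    abel
  generalize (1 + (Polynomial.X : Polynomial ℂ) • M.map Polynomial.C).det.divX.divX = P at h1
  have h2 : HasDerivAt (fun w : ℂ => w - t) 1 t := (hasDerivAt_id t).sub_const t
  have h3 : HasDerivAt (fun w : ℂ => Polynomial.eval (w - t) P)
      (Polynomial.eval (t - t) P.derivative) t := (P.hasDerivAt (t - t)).comp_sub_const t t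
  have h4 := (((h2.const_mul M.trace).const_add 1).add (h3.mul (h2.pow 2))).const_mul A.det
  have h5 : (fun t : ℂ => (1 + t • H).det) = _ := funext h1
  rw [h5]
  refine h4.congr_deriv ?_
  simp

section OperatorNorm

attribute [local instance] Matrix.linftyOpNormedRing Matrix.linftyOpNormedAlgebra

lemma hasDerivAt_dotProduct_inv_mulVec (H : Matrix (Fin N) (Fin N) ℂ) (a b : Fin N → ℂ) {t : ℂ}
    (ht : IsUnit (1 + t • H).det) :
    HasDerivAt (fun t : ℂ => a ⬝ᵥ ((1 + t • H)⁻¹ *ᵥ b))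
      (-(a ⬝ᵥ (((1 + t • H)⁻¹ * H * (1 + t • H)⁻¹) *ᵥ b))) t := by
  have hu : IsUnit (1 + t • H) := (Matrix.isUnit_iff_isUnit_det _).2 ht
  have h1 : HasDerivAt (fun t : ℂ => 1 + t • H) H t := 
    (((hasDerivAt_id t).smul_const H).const_add 1).congr_deriv (one_smul ℂ H)
  have h2 : HasFDerivAt Ring.inverse _ (1 + t • H) := hasFDerivAt_ringInverse (𝕜 := ℂ) hu.unit
  have h3 := h2.comp_hasDerivAt t h1
  let L : Matrix (Fin N) (Fin N) ℂ →ₗ[ℂ] ℂ :=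
    { toFun := fun M => a ⬝ᵥ (M *ᵥ b)
      map_add' := fun M M' => by rw [Matrix.add_mulVec, dotProduct_add]
      map_smul' := fun c M => by rw [Matrix.smul_mulVec, dotProduct_smul, RingHom.id_apply] }
  have h4 := (LinearMap.toContinuousLinearMap L).hasFDerivAt.comp_hasDerivAt t h3
  have h5 : ((hu.unit⁻¹ : (Matrix (Fin N) (Fin N) ℂ)ˣ) : Matrix (Fin N) (Fin N) ℂ) =
      (1 + t • H)⁻¹ := by
    rw [Matrix.coe_units_inv, hu.unit_spec]
  rw [h5] at h4
  have h6 : (fun t : ℂ => a ⬝ᵥ ((1 + t • H)⁻¹ *ᵥ b)) =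
      (LinearMap.toContinuousLinearMap L) ∘ Ring.inverse ∘ fun t : ℂ => 1 + t • H := by
    funext w
    simp only [Function.comp, LinearMap.coe_toContinuousLinearMap',
      ← Matrix.nonsing_inv_eq_ringInverse]
    rfl
  rw [h6]
  refine h4.congr_deriv ?_
  change a ⬝ᵥ (-((1 + t • H)⁻¹ * H * (1 + t • H)⁻¹) *ᵥ b) = _
  rw [Matrix.neg_mulVec, dotProduct_neg]

end OperatorNorm

/-- A matrix with entries smaller than `1 / N` does not affect invertibility of the identity, by
strict diagonal dominance. -/
lemma isUnit_det_one_add {H : Matrix (Fin N) (Fin N) ℂ} {s : ℝ} (hsN : N * s < 1)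
    (hH : ∀ m n, ‖H m n‖ ≤ s) : IsUnit (1 + H).det := by
  refine isUnit_iff_ne_zero.2 (det_ne_zero_of_sum_row_lt_diag fun k => ?_)
  have h1 : ∑ j ∈ Finset.univ.erase k, ‖(1 + H) k j‖ = ∑ j ∈ Finset.univ.erase k, ‖H k j‖ :=
    Finset.sum_congr rfl fun j hj => by
      rw [Matrix.add_apply, Matrix.one_apply_ne (Finset.ne_of_mem_erase hj).symm, zero_add]
  have h2 : ‖H k k‖ + ∑ j ∈ Finset.univ.erase k, ‖H k j‖ ≤ N * s := by
    rw [Finset.add_sum_erase _ (fun j => ‖H k j‖) (Finset.mem_univ k)]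
    simpa using Finset.sum_le_sum fun j (_ : j ∈ Finset.univ) => hH k j
  have h3 : 1 ≤ ‖(1 + H) k k‖ + ‖H k k‖ := by
    rw [Matrix.add_apply, Matrix.one_apply_eq]
    simpa using norm_sub_le (1 + H k k) (H k k)
  rw [h1]
  linarith

lemma shiftedSum_zero (a b : Fin N → ℂ) : shiftedSum 0 a b 0 0 = 1 := by
  unfold shiftedSum
  rw [tsum_eq_single 0]
  · simp [shiftedTerm, expCoeff, hermiteProd, rowTotal, colTotal]
  · intro K hK
    obtain ⟨m, n, hmn⟩ : ∃ m n, K m n ≠ 0 := by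
      by_contra! h
      exact hK (Matrix.ext h)
    have : expCoeff (0 : Matrix (Fin N) (Fin N) ℂ) K = 0 :=
      Finset.prod_eq_zero (Finset.mem_univ m)
        (Finset.prod_eq_zero (Finset.mem_univ n) (by simp [hmn]))
    rw [shiftedTerm, this, zero_mul]

/-- The sum of the multilinear series with independent arguments `a` and `b`. The quotient of the
series by its closed form has derivative zero along `t ↦ t • H`, and is `1` at `t = 0`. -/
theorem shiftedSum_eq {H : Matrix (Fin N) (Fin N) ℂ} {s : ℝ} (hs : 0 ≤ s)
    (hsN : N * s < 1) (hH : ∀ m n, ‖H m n‖ ≤ s) (a b : Fin N → ℂ) :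
    shiftedSum H a b 0 0 =
      (1 + H).det⁻¹ * Complex.exp (a ⬝ᵥ ((H * (1 + H)⁻¹) *ᵥ b)) := by
  have hθ : 0 ≤ N * s := by positivity
  -- A radius `τ > 1` for which `τ • H` still has entries smaller than `1 / N`.
  obtain ⟨τ, hτ1, hτN⟩ : ∃ τ : ℝ, 1 < τ ∧ N * (τ * s) < 1 := by
    refine ⟨2 / (1 + N * s), ?_, ?_⟩
    · rw [lt_div_iff₀ (by positivity)]
      linarith
    · rw [show N * (2 / (1 + N * s) * s) = 2 * (N * s) / (1 + N * s) by ring,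
        div_lt_one (by positivity)]
      linarith
  have hτ0 : 0 ≤ τ := by linarith
  have hunit : ∀ t ∈ Metric.ball (0 : ℂ) τ, IsUnit (1 + t • H).det := fun t ht =>
    isUnit_det_one_add hτN (norm_smul_apply_le hH ht)
  -- The exponent `a ⬝ t H (1 + t H)⁻¹ b` equals `a ⬝ b - a ⬝ (1 + t H)⁻¹ b`.
  have hG : ∀ t ∈ Metric.ball (0 : ℂ) τ,
      HasDerivAt (fun t : ℂ => shiftedSum (t • H) a b 0 0 * (1 + t • H).det *
        Complex.exp (a ⬝ᵥ ((1 + t • H)⁻¹ *ᵥ b) - a ⬝ᵥ b)) 0 t := by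
    intro t ht
    have h := ((hasDerivAt_shiftedSum hs hτ0 hτN hH a b ht).mul
      (hasDerivAt_det_one_add_smul H (hunit t ht))).mul
      ((hasDerivAt_dotProduct_inv_mulVec H a b (hunit t ht)).sub_const (a ⬝ᵥ b)).cexp
    refine h.congr_deriv ?_
    rw [sum_mul_shiftedSum (mul_nonneg hτ0 hs) hτN (norm_smul_apply_le hH ht) (hunit t ht)]
    simp only [Pi.mul_apply]
    ring
  have h1 : (1 : ℂ) ∈ Metric.ball (0 : ℂ) τ := by simpa using hτ1
  have h0 : (0 : ℂ) ∈ Metric.ball (0 : ℂ) τ := Metric.mem_ball_self (by linarith)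
  have hconst := Metric.isOpen_ball.is_const_of_deriv_eq_zero
    (convex_ball (0 : ℂ) τ).isPreconnected
    (fun t ht => (hG t ht).differentiableAt.differentiableWithinAt)
    (fun t ht => (hG t ht).deriv) h1 h0
  simp only [one_smul, zero_smul, add_zero, shiftedSum_zero, Matrix.det_one, inv_one,
    Matrix.one_mulVec, sub_self, Complex.exp_zero, mul_one] at hconst
  have hu : IsUnit (1 + H).det := isUnit_det_one_add hsN hH
  have hexp : a ⬝ᵥ ((H * (1 + H)⁻¹) *ᵥ b) = -(a ⬝ᵥ ((1 + H)⁻¹ *ᵥ b) - a ⬝ᵥ b) := by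
    have : H * (1 + H)⁻¹ = 1 - (1 + H)⁻¹ := by
      rw [eq_sub_iff_add_eq, add_comm]
      nth_rewrite 1 [← Matrix.one_mul (1 + H)⁻¹]
      rw [← Matrix.add_mul, Matrix.mul_nonsing_inv _ hu]
    rw [this, Matrix.sub_mulVec, Matrix.one_mulVec, dotProduct_sub]
    ring
  rw [hexp, Complex.exp_neg, ← mul_inv]
  exact eq_inv_of_mul_eq_one_left (by rw [← mul_assoc, hconst])

/-! ### The unit ball of the entrywise norm and its polydiscs -/

section EntrywiseNorm

attribute [local instance] Matrix.normedAddCommGroup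

lemma mem_maxNormBall_iff (hN : 0 < N) {H : Matrix (Fin N) (Fin N) ℂ} :
    H ∈ maxNormBall N ↔ ∀ m n, ‖H m n‖ < 1 / (N : ℝ) :=
  Matrix.norm_lt_iff (by positivity)

lemma exists_forall_norm_apply_le_of_isCompact (hN : 0 < N)
    {S : Set (Matrix (Fin N) (Fin N) ℂ)} (hS : IsCompact S) (hSB : S ⊆ maxNormBall N) :
    ∃ s : ℝ, 0 ≤ s ∧ N * s < 1 ∧ ∀ H ∈ S, ∀ m n, ‖H m n‖ ≤ s := by
  rcases S.eq_empty_or_nonempty with rfl | hne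
  · exact ⟨0, le_rfl, by simp, by simp⟩
  · obtain ⟨H₁, h₁, hmax⟩ := hS.exists_isMaxOn hne continuous_norm.continuousOn
    refine ⟨‖H₁‖, norm_nonneg _, ?_, fun H hH m n =>
      (Matrix.norm_entry_le_entrywise_sup_norm H).trans (hmax hH)⟩
    have h : ‖H₁‖ < 1 / (N : ℝ) := hSB h₁
    rwa [lt_div_iff₀' (by positivity)] at h

end EntrywiseNorm

lemma polydiscAt_zero_subset_maxNormBall (hN : 0 < N) :
    polydiscAt (0 : Matrix (Fin N) (Fin N) ℂ)
        (Matrix.of (fun _ _ => 1 / (2 * (N : ℝ))) +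
          (1 / (2 * (N : ℝ))) • (1 : Matrix (Fin N) (Fin N) ℝ)) ⊆
      maxNormBall N := by
  rintro H ⟨hd, ho⟩
  rw [mem_maxNormBall_iff hN]
  have hsum : 1 / (2 * (N : ℝ)) + 1 / (2 * (N : ℝ)) = 1 / (N : ℝ) := by
    field_simp
    norm_num
  have huv : ∀ l k, l < k → ‖uCoord H l k‖ + ‖vCoord H l k‖ < 1 / (N : ℝ) := by
    intro l k hlk
    obtain ⟨h1, h2⟩ := ho l k hlk
    simp [uCoord, vCoord, Matrix.one_apply_ne hlk.ne] at h1 h2 hsum ⊢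
    linarith
  intro m n
  rcases lt_trichotomy m n with h | rfl | h
  · have : H m n = uCoord H m n + Complex.I * vCoord H m n := by
      unfold uCoord vCoord
      field_simp
      ring
    rw [this]
    refine (norm_add_le _ _).trans_lt ?_
    simpa using huv m n h
  · have := hd m
    simp at this hsum ⊢
    linarith
  · have : H m n = uCoord H n m - Complex.I * vCoord H n m := by
      unfold uCoord vCoord
      field_simp
      ring
    rw [this]
    refine (norm_sub_le _ _).trans_lt ?_
    simpa using huv n m h

theorem theorem1p3 (N : ℕ) (hN : 0 < N) :
    -- the series converges absolutely and uniformly on compact sets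
    (∀ (S : Set (Matrix (Fin N) (Fin N) ℂ)) (T : Set (Fin N → ℂ)),
      IsCompact S → S ⊆ maxNormBall N → IsCompact T →
        HasSumUniformlyOn
          (fun (K : Matrix (Fin N) (Fin N) ℕ) (p : Matrix (Fin N) (Fin N) ℂ × (Fin N → ℂ)) =>
            ‖multilinearTerm K p.1 p.2‖)
          (fun p => ∑' K : Matrix (Fin N) (Fin N) ℕ, ‖multilinearTerm K p.1 p.2‖) (S ×ˢ T) ∧
        HasSumUniformlyOn
          (fun (K : Matrix (Fin N) (Fin N) ℕ) (p : Matrix (Fin N) (Fin N) ℂ × (Fin N → ℂ)) =>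
            multilinearTerm K p.1 p.2)
          (fun p => ∑' K : Matrix (Fin N) (Fin N) ℕ, multilinearTerm K p.1 p.2) (S ×ˢ T)) ∧
    -- the value of the sum on polydiscs around Hermitian matrices
    (∀ (H₀ : Matrix (Fin N) (Fin N) ℂ) (δ : Matrix (Fin N) (Fin N) ℝ),
      H₀.IsHermitian → H₀ ∈ maxNormBall N → (∀ j k, 0 < δ j k) →
      polydiscAt H₀ δ ⊆ maxNormBall N →
        ∀ H ∈ polydiscAt H₀ δ, ∀ W : Fin N → ℂ,
          IsUnit (1 + H).det ∧
          HasSum (fun K : Matrix (Fin N) (Fin N) ℕ => multilinearTerm K H W)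
            ((1 + H).det⁻¹ * Complex.exp (star W ⬝ᵥ ((H * (1 + H)⁻¹) *ᵥ W))) ∧
          Complex.exp (star W ⬝ᵥ ((H * (1 + H)⁻¹) *ᵥ W)) =
            (1 + H).det * ∑' K : Matrix (Fin N) (Fin N) ℕ, multilinearTerm K H W) ∧
    -- an explicit polydisc contained in the ball
    polydiscAt (0 : Matrix (Fin N) (Fin N) ℂ)
        (Matrix.of (fun _ _ => 1 / (2 * (N : ℝ))) +
          (1 / (2 * (N : ℝ))) • (1 : Matrix (Fin N) (Fin N) ℝ)) ⊆
      maxNormBall N := by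
  refine ⟨fun S T hS hSB hT => ?_, fun H₀ δ _ _ _ hsub H hH W => ?_,
    polydiscAt_zero_subset_maxNormBall hN⟩
  · obtain ⟨s, hs, hsN, hSs⟩ := exists_forall_norm_apply_le_of_isCompact hN hS hSB
    obtain ⟨R, hR⟩ := hT.isBounded.exists_norm_le
    obtain ⟨u, hu, hub⟩ := exists_summable_bound (N := N) 0 0 R hs hsN
    have hb : ∀ (K : Matrix (Fin N) (Fin N) ℕ) (p : Matrix (Fin N) (Fin N) ℂ × (Fin N → ℂ)),
        p ∈ S ×ˢ T → ‖multilinearTerm K p.1 p.2‖ ≤ u K := by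
      rintro K ⟨H, W⟩ ⟨hH, hW⟩
      have hWR : ∀ j, ‖W j‖ ≤ R := fun j => (norm_le_pi_norm W j).trans (hR W hW)
      -- Unshifted terms with `a = star W` and `b = W` are the given ones by definition.
      exact hub K H (star W) W (hSs H hH) (fun j => by simpa using hWR j) hWR
    exact ⟨.of_norm_le_summable hu fun K p hp => by simpa using hb K p hp,
      .of_norm_le_summable hu hb⟩
  · obtain ⟨s, hs, hsN, hSs⟩ := exists_forall_norm_apply_le_of_isCompact hN
      (isCompact_singleton (x := H)) (by simpa using hsub hH)
    have hHs := hSs H rfl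
    have hunit : IsUnit (1 + H).det := isUnit_det_one_add hsN hHs
    have hsum : HasSum (fun K : Matrix (Fin N) (Fin N) ℕ => multilinearTerm K H W)
        ((1 + H).det⁻¹ * Complex.exp (star W ⬝ᵥ ((H * (1 + H)⁻¹) *ᵥ W))) := by
      rw [← shiftedSum_eq hs hsN hHs]
      exact (summable_shiftedTerm hs hsN hHs (star W) W 0 0).hasSum
    refine ⟨hunit, hsum, ?_⟩
    rw [hsum.tsum_eq, mul_inv_cancel_left₀ hunit.ne_zero]
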